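/- Let $B=(B,d,h)$ be a curved DG-ring (CDG-ring): a $\mathbb Z$-graded associative unital ring $B=\bigoplus_{i\in\mathbb Z}B^i$ with an odd derivation $d$ of degree $1$ and an element $h\in B^2$ such that $d^2(b)=hb-bh$ for all $b\in B$ and $d(h)=0$. A (left) CDG-module over $B$ is a graded left $B$-module $M$ with an additive map $d_M$ of degree $1$ such that $d_M(bx)=d(b)x+(-1)^{|b|}b\,d_M(x)$ for homogeneous $b$ and $x$, and $d_M^2(x)=hx$. Let $\mathsf{Hot}$ be the triangulated homotopy category of left CDG-modules over $B$: its morphisms are the closed morphisms of degree $0$ (homogeneous $B$-linear maps of degree $0$ commuting with the differentials) up to cochain homotopy. A short exact sequence of CDG-modules $0\to K\xrightarrow{f}L\xrightarrow{g}M\to0$ is a pair of closed morphisms of degree $0$ that is a short exact sequence of graded $B$-modules; its totalization is $\mathrm{cone}(\mathrm{cone}(f)\to M)$. A CDG-module is called absolutely acyclic if it belongs to the minimal thick subcategory of $\mathsf{Hot}$ containing the totalizations of all short exact sequences of CDG-modules; coacyclic (respectively, contraacyclic) if it belongs to the minimal triangulated subcategory of $\mathsf{Hot}$ containing these totalizations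 and closed under infinite direct sums (respectively, infinite products). (a) Let $M$ be a CDG-module over $B$ with a finite filtration $0=F_0M\subset F_1M\subset\dotsb\subset F_nM=M$ by CDG-submodules such that $F_iM/F_{i-1}M$ is absolutely acyclic for every $1\le i\le n$. Then $M$ is absolutely acyclic. (b) Let $N$ be a CDG-module over $B$ with an increasing filtration $0=F_0N\subset F_1N\subset F_2N\subset\dotsb$ by CDG-submodules that is exhaustive, $N=\bigcup_{i\ge0}F_iN$, and such that $F_iN/F_{i-1}N$ is coacyclic for every $i\ge1$. Then $N$ is coacyclic. (c) Let $Q$ be a CDG-module over $B$ with a decreasing filtration $Q=F^0Q\supset F^1Q\supset F^2Q\supset\dotsb$ by CDG-submodules that is separated and complete, that is, the natural map $Q\to\varprojlim_{i\ge1}Q/F^iQ$ is an isomorphism (the limit being taken in graded modules, i.e. in each degree), and such that $F^iQ/F^{i+1}Q$ is contraacyclic for every $i\ge0$. Then $Q$ is contraacyclic. -/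

import Mathlib

open CategoryTheory

universe u v

/-- A curved DG-ring `(B, d, h)`: a `ℤ`-graded ring `B = ⨁ Bⁱ` with an odd derivation `d` of
degree `1` and a curvature element `h ∈ B²` with `d² (b) = h b - b h` and `d (h) = 0`. -/
structure CDGRing where
  carrier : Type u
  [ring : Ring carrier]
  /-- the homogeneous components `Bⁱ` -/
  deg : ℤ → AddSubgroup carrier
  [graded : GradedRing deg]
  d : carrier →+ carrier
  d_mem : ∀ {i : ℤ} {b : carrier}, b ∈ deg i → d b ∈ deg (i + 1)
  leibniz : ∀ {i : ℤ} {b : carrier} (c : carrier), b ∈ deg i →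
    d (b * c) = d b * c + i.negOnePow • (b * d c)
  curv : carrier
  curv_mem : curv ∈ deg 2
  d_d : ∀ b : carrier, d (d b) = curv * b - b * curv
  d_curv : d curv = 0

namespace CDGRing

attribute [instance] CDGRing.ring CDGRing.graded

variable (B : CDGRing.{u})

/-- The unit as an element of `B⁰`. -/
def oneEl : B.deg 0 := ⟨1, SetLike.GradedOne.one_mem⟩

/-- The product of two homogeneous elements, as an element of `Bᵏ` for `i + j = k`. -/
def mulEl {i j k : ℤ} (hk : i + j = k) (a : B.deg i) (b : B.deg j) : B.deg k :=
  ⟨a.1 * b.1, hk ▸ SetLike.GradedMul.mul_mem a.2 b.2⟩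

/-- The derivation as a map `Bⁱ → Bʲ` for `i + 1 = j`. -/
def dEl {i j : ℤ} (hj : i + 1 = j) (b : B.deg i) : B.deg j :=
  ⟨B.d b.1, hj ▸ B.d_mem b.2⟩

/-- The curvature as an element of `B²`. -/
def curvEl : B.deg 2 := ⟨B.curv, B.curv_mem⟩

end CDGRing

/-- A left CDG-module `(M, d_M)` over `B`: a graded left `B`-module, given by its components `Mⁱ`
and the action maps `Bⁱ × Mʲ → Mⁱ⁺ʲ`, with an odd derivation `d_M` of degree `1` compatible
with the derivation on `B` and such that `d_M² (x) = h x`.  The target index of an operation is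
a free variable constrained by an equation, which avoids casts. -/
structure CDGModule (B : CDGRing.{u}) where
  X : ℤ → Type v
  [addCommGroup : ∀ i, AddCommGroup (X i)]
  smul : ∀ {i j k : ℤ}, i + j = k → (B.deg i →+ X j →+ X k)
  one_smul : ∀ {j : ℤ} (x : X j), smul (zero_add j) B.oneEl x = x
  mul_smul : ∀ {i j k l m n : ℤ} (hl : i + j = l) (hm : j + k = m) (h₁ : l + k = n)
    (h₂ : i + m = n) (a : B.deg i) (b : B.deg j) (x : X k),
    smul h₁ (B.mulEl hl a b) x = smul h₂ a (smul hm b x)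
  d : ∀ {i j : ℤ}, i + 1 = j → (X i →+ X j)
  leibniz : ∀ {i j k i₁ j₁ k₁ : ℤ} (hi : i + 1 = i₁) (hj : j + 1 = j₁) (hk : k + 1 = k₁)
    (h₀ : i + j = k) (h₁ : i₁ + j = k₁) (h₂ : i + j₁ = k₁) (b : B.deg i) (x : X j),
    d hk (smul h₀ b x) = smul h₁ (B.dEl hi b) x + i.negOnePow • smul h₂ b (d hj x)
  d_d : ∀ {i j k : ℤ} (hj : i + 1 = j) (hk : j + 1 = k) (hc : 2 + i = k) (x : X i),
    d hk (d hj x) = smul hc B.curvEl x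

namespace CDGModule

attribute [instance] CDGModule.addCommGroup

variable {B : CDGRing.{u}}

/-- Closed morphisms of degree `0`: homogeneous `B`-linear maps of degree `0` that commute with
the differentials. -/
@[ext]
structure Hom (M N : CDGModule.{u, v} B) where
  f : ∀ i, M.X i →+ N.X i
  map_smul : ∀ {i j k : ℤ} (hk : i + j = k) (b : B.deg i) (x : M.X j),
    f k (M.smul hk b x) = N.smul hk b (f j x)
  map_d : ∀ {i j : ℤ} (hj : i + 1 = j) (x : M.X i), f j (M.d hj x) = N.d hj (f i x)

/-- The category of CDG-modules and closed morphisms of degree `0`. -/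
instance : Category (CDGModule.{u, v} B) where
  Hom := Hom
  id M := ⟨fun i => AddMonoidHom.id (M.X i), fun _ _ _ => rfl, fun _ _ => rfl⟩
  comp f g := ⟨fun i => (g.f i).comp (f.f i),
    fun hk b x => by simp [f.map_smul, g.map_smul], fun hj x => by simp [f.map_d, g.map_d]⟩

@[simp] lemma id_f (M : CDGModule.{u, v} B) (i : ℤ) (x : M.X i) : Hom.f (𝟙 M) i x = x := rfl

@[simp] lemma comp_f {K L M : CDGModule.{u, v} B} (f : K ⟶ L) (g : L ⟶ M) (i : ℤ) (x : K.X i) :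
    Hom.f (f ≫ g) i x = g.f i (f.f i x) := rfl

/-- The component of a morphism, with source and target index identified by an equation. -/
def Hom.fEq {M N : CDGModule.{u, v} B} (f : Hom M N) {i j : ℤ} (h : i = j) : M.X i →+ N.X j :=
  h ▸ f.f i

@[simp] lemma Hom.fEq_rfl {M N : CDGModule.{u, v} B} (f : Hom M N) (i : ℤ) :
    f.fEq (rfl : i = i) = f.f i := rfl

/-- A cochain homotopy between closed morphisms `f` and `g` of degree `0`: a homogeneous
`B`-linear map `s` of degree `-1` (with the Koszul sign) such that `f - g = d s + s d`. -/
structure Homotopy {M N : CDGModule.{u, v} B} (f g : M ⟶ N) where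
  s : ∀ {i j : ℤ}, j + 1 = i → (M.X i →+ N.X j)
  map_smul : ∀ {i j k j₁ k₁ : ℤ} (hk : i + j = k) (hj₁ : j₁ + 1 = j) (hk₁ : k₁ + 1 = k)
    (h₁ : i + j₁ = k₁) (b : B.deg i) (x : M.X j),
    s hk₁ (M.smul hk b x) = i.negOnePow • N.smul h₁ b (s hj₁ x)
  eq : ∀ {i j k : ℤ} (hi : i + 1 = j) (hj : j + 1 = k) (x : M.X j),
    f.f j x - g.f j x = N.d hi (s hi x) + s hj (M.d hj x)

/-- The homotopy relation on closed morphisms of degree `0`. -/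
def homotopic : HomRel (CDGModule.{u, v} B) := fun _ _ f g => Nonempty (Homotopy f g)

instance : Congruence (homotopic (B := B)) where
  equivalence := by
    intro M N
    refine ⟨fun f => ⟨⟨fun _ => 0, by simp, by simp⟩⟩, ?_, ?_⟩
    · rintro f g ⟨s⟩
      refine ⟨⟨fun h => - s.s h, ?_, ?_⟩⟩
      · intro i j k j₁ k₁ hk hj₁ hk₁ h₁ b x
        simp [s.map_smul hk hj₁ hk₁ h₁ b x]
      · intro i j k hi hj x
        rw [← neg_sub, s.eq hi hj x]
        simp
        abel
    · rintro f g h ⟨s⟩ ⟨t⟩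
      refine ⟨⟨fun h => s.s h + t.s h, ?_, ?_⟩⟩
      · intro i j k j₁ k₁ hk hj₁ hk₁ h₁ b x
        simp [s.map_smul hk hj₁ hk₁ h₁ b x, t.map_smul hk hj₁ hk₁ h₁ b x]
      · intro i j k hi hj x
        rw [← sub_add_sub_cancel _ (g.f j x), s.eq hi hj x, t.eq hi hj x]
        simp
        abel
  comp_left := by
    rintro K M N e f g ⟨s⟩
    refine ⟨⟨fun {i j} h => (s.s h).comp (e.f i), ?_, ?_⟩⟩
    · intro i j k j₁ k₁ hk hj₁ hk₁ h₁ b x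
      simp [e.map_smul, s.map_smul hk hj₁ hk₁ h₁]
    · intro i j k hi hj x
      have := s.eq hi hj (e.f j x)
      simpa [e.map_d] using this
  comp_right := by
    rintro M N K f g e ⟨s⟩
    refine ⟨⟨fun {i j} h => (e.f j).comp (s.s h), ?_, ?_⟩⟩
    · intro i j k j₁ k₁ hk hj₁ hk₁ h₁ b x
      simp [s.map_smul hk hj₁ hk₁ h₁, e.map_smul, Units.smul_def]
    · intro i j k hi hj x
      have := congrArg (e.f j) (s.eq hi hj x)
      simpa [e.map_d] using this

variable (B) in
/-- The homotopy category of left CDG-modules: closed morphisms of degree `0` up to cochain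
homotopy. -/
abbrev Hot : Type _ := Quotient (homotopic.{u, v} (B := B))

/-- A CDG-module viewed as an object of the homotopy category. -/
abbrev toHot (M : CDGModule.{u, v} B) : Hot.{u, v} B :=
  (Quotient.functor (homotopic.{u, v} (B := B))).obj M

/-- The shift `M[n]`, with `M[n]ⁱ = Mⁱ⁺ⁿ`, differential `(-1)ⁿ d_M` and action
`(b, x) ↦ (-1)^(n|b|) b x`. -/
def shift (M : CDGModule.{u, v} B) (n : ℤ) : CDGModule.{u, v} B where
  X i := M.X (i + n)
  smul {i j k} hk := (n * i).negOnePow • M.smul (show i + (j + n) = k + n by omega)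
  one_smul {j} x := by
    have key : ∀ (k : ℤ) (h : 0 + k = k) (y : M.X k), M.smul h B.oneEl y = y :=
      fun k h y => M.one_smul y
    simp [key]
  mul_smul {i j k l m p} hl hm h₁ h₂ a b x := by
    subst hl
    simp only [AddMonoidHom.smul_apply, mul_add, Int.negOnePow_add,
      map_zsmul, Units.smul_def, Units.val_mul, smul_smul]
    rw [← M.mul_smul rfl (by omega) (by omega) (by omega), mul_comm]
  d {i j} hj := n.negOnePow • M.d (show i + n + 1 = j + n by omega)
  leibniz {i j k i₁ j₁ k₁} hi hj hk h₀ h₁ h₂ b x := by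
    subst hi
    simp only [AddMonoidHom.smul_apply, mul_add, Int.negOnePow_add, mul_one,
      map_zsmul, Units.smul_def, Units.val_mul, smul_smul]
    rw [M.leibniz rfl (show j + n + 1 = j₁ + n by omega) _ _ (by omega) (by omega)]
    simp only [smul_add, smul_smul, Units.smul_def]
    congr 2
    ring
  d_d {i j k} hj hk hc x := by
    simp only [AddMonoidHom.smul_apply, map_zsmul, Units.smul_def, smul_smul]
    rw [M.d_d _ _ (show 2 + (i + n) = k + n by omega), mul_comm n 2, two_mul,
      Int.negOnePow_add, Units.val_mul]

/-- The cone of a closed morphism `f : K ⟶ L` of degree `0`: the graded module `L ⊕ K[1]` with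
the differential `(l, k) ↦ (d l + f k, - d k)`. -/
def cone {K L : CDGModule.{u, v} B} (f : K ⟶ L) : CDGModule.{u, v} B where
  X i := L.X i × K.X (i + 1)
  smul {i j k} hk := AddMonoidHom.mk'
    (fun b => (L.smul hk b).prodMap
      (i.negOnePow • K.smul (show i + (j + 1) = k + 1 by omega) b))
    (by intro a b; ext x <;> simp)
  one_smul {j} x := by
    have key : ∀ (k : ℤ) (h : 0 + k = k) (y : K.X k), K.smul h B.oneEl y = y :=
      fun k h y => K.one_smul y
    ext <;> simp [key, L.one_smul]
  mul_smul {i j k l m p} hl hm h₁ h₂ a b x := by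
    subst hl
    refine Prod.ext (L.mul_smul rfl hm h₁ h₂ a b x.1) ?_
    change (i + j).negOnePow • K.smul _ _ x.2 =
      i.negOnePow • K.smul _ a (j.negOnePow • K.smul (show j + (k + 1) = m + 1 by omega) b x.2)
    simp only [Int.negOnePow_add, map_zsmul, Units.smul_def, Units.val_mul, smul_smul]
    rw [← K.mul_smul rfl (by omega) (by omega) (by omega)]
  d {i j} hj := ((L.d hj).coprod (f.fEq hj)).prod
    ((-K.d (show i + 1 + 1 = j + 1 by omega)).comp (AddMonoidHom.snd _ _))
  leibniz {i j k i₁ j₁ k₁} hi hj hk h₀ h₁ h₂ b x := by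
    subst hi hj hk
    refine Prod.ext ?_ ?_
    · change L.d rfl (L.smul h₀ b x.1) + f.f _ (i.negOnePow • K.smul _ b x.2) =
        L.smul _ _ x.1 + i.negOnePow • L.smul h₂ b (L.d rfl x.1 + f.f _ x.2)
      rw [L.leibniz rfl rfl rfl h₀ h₁ h₂]
      simp only [map_add, smul_add, Units.smul_def, map_zsmul, f.map_smul]
      abel
    · change -K.d rfl (i.negOnePow • K.smul _ b x.2) =
        (i + 1).negOnePow • K.smul (show i + 1 + (j + 1) = k + 1 + 1 by omega) _ x.2 +
          i.negOnePow • i.negOnePow • K.smul (show i + (j + 1 + 1) = k + 1 + 1 by omega) b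
            (-K.d rfl x.2)
      simp only [Units.smul_def, map_zsmul, Int.negOnePow_succ, Units.val_neg, map_neg]
      rw [K.leibniz rfl rfl rfl (show i + (j + 1) = k + 1 by omega)
        (show i + 1 + (j + 1) = k + 1 + 1 by omega) (show i + (j + 1 + 1) = k + 1 + 1 by omega)]
      simp only [Units.smul_def, smul_add, smul_neg, neg_smul, neg_add]
  d_d {i j k} hj hk hc x := by
    subst hj hk
    refine Prod.ext ?_ ?_
    · change L.d rfl (L.d rfl x.1 + f.f _ x.2) + f.f _ (-K.d rfl x.2) = L.smul hc _ x.1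
      rw [map_add, L.d_d rfl rfl hc, map_neg, f.map_d]
      abel
    · change -K.d rfl (-K.d rfl x.2) = (2 : ℤ).negOnePow • K.smul _ _ x.2
      rw [map_neg, neg_neg, K.d_d rfl rfl (show 2 + (i + 1) = i + 1 + 1 + 1 by omega),
        Int.negOnePow_even 2 (by decide), _root_.one_smul]

/-- The canonical morphism `cone f ⟶ M`, `(l, k) ↦ g l`, for closed morphisms `f : K ⟶ L` and
`g : L ⟶ M` with `g f = 0`. -/
def coneDesc {K L M : CDGModule.{u, v} B} (f : K ⟶ L) (g : L ⟶ M)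
    (w : ∀ (i : ℤ) (x : K.X i), g.f i (f.f i x) = 0) : cone f ⟶ M where
  f i := (g.f i).comp (AddMonoidHom.fst _ _)
  map_smul hk b x := g.map_smul hk b x.1
  map_d := by
    rintro i j rfl x
    change g.f _ (L.d rfl x.1 + f.f _ x.2) = M.d rfl (g.f _ x.1)
    rw [map_add, w, add_zero, g.map_d]

variable (B) in
/-- A short exact sequence `0 ⟶ K ⟶ L ⟶ M ⟶ 0` of CDG-modules: closed morphisms of degree `0`
that form a short exact sequence of graded `B`-modules. -/
structure ShortExactSeq where
  K : CDGModule.{u, v} B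
  L : CDGModule.{u, v} B
  M : CDGModule.{u, v} B
  f : K ⟶ L
  g : L ⟶ M
  injective : ∀ i, Function.Injective (f.f i)
  exact : ∀ i, Function.Exact (f.f i) (g.f i)
  surjective : ∀ i, Function.Surjective (g.f i)

/-- The totalization `Tot(K ⟶ L ⟶ M) = cone(cone(f) ⟶ M)`. -/
def ShortExactSeq.tot (S : ShortExactSeq.{u, v} B) : CDGModule.{u, v} B :=
  cone (coneDesc S.f S.g fun i x => (S.exact i).apply_apply_eq_zero x)

/-- The direct sum of a family of CDG-modules, formed in each degree. -/
def directSum {J : Type v} (M : J → CDGModule.{u, v} B) : CDGModule.{u, v} B where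
  X i := DirectSum J fun j => (M j).X i
  smul hk := AddMonoidHom.mk' (fun b => DirectSum.map fun j => (M j).smul hk b)
    (by intro a b; ext x; simp)
  one_smul x := by
    ext j; exact (M j).one_smul (x j)
  mul_smul hl hm h₁ h₂ a b x := by
    ext j; exact (M j).mul_smul hl hm h₁ h₂ a b (x j)
  d hj := DirectSum.map fun j => (M j).d hj
  leibniz {i _ _ _ _ _} hi hj hk h₀ h₁ h₂ b x := by
    ext j
    have := (M j).leibniz hi hj hk h₀ h₁ h₂ b (x j)
    have neg_apply : ∀ {k : ℤ} (y : DirectSum J fun j => (M j).X k), (-y) j = -(y j) :=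
      fun _ => rfl
    rcases Int.units_eq_one_or i.negOnePow with h | h <;> rw [h] at this ⊢ <;>
      simpa [neg_apply] using this
  d_d hj hk hc x := by
    ext j; exact (M j).d_d hj hk hc (x j)

/-- The product of a family of CDG-modules, formed in each degree. -/
def product {J : Type v} (M : J → CDGModule.{u, v} B) : CDGModule.{u, v} B where
  X i := ∀ j, (M j).X i
  smul hk := AddMonoidHom.mk' (fun b => AddMonoidHom.mk' (fun x j => (M j).smul hk b (x j))
    (by intro x y; ext j; simp)) (by intro a b; ext x j; simp)
  one_smul x := by
    ext j; simp [(M j).one_smul]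
  mul_smul hl hm h₁ h₂ a b x := by
    ext j; exact (M j).mul_smul hl hm h₁ h₂ a b (x j)
  d hj := AddMonoidHom.mk' (fun x j => (M j).d hj (x j)) (by intro x y; ext j; simp)
  leibniz hi hj hk h₀ h₁ h₂ b x := by
    ext j; exact (M j).leibniz hi hj hk h₀ h₁ h₂ b (x j)
  d_d hj hk hc x := by
    ext j; exact (M j).d_d hj hk hc (x j)

/-- A full triangulated subcategory of the homotopy category: a nonempty class of objects closed
under isomorphisms in the homotopy category (homotopy equivalences), under all shifts and under
the cones of all closed morphisms of degree `0`. -/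
structure IsTriangulatedSubcategory (P : ObjectProperty (Hot.{u, v} B)) : Prop where
  nonempty : ∃ X, P X
  iso : P.IsClosedUnderIsomorphisms
  shift : ∀ (M : CDGModule.{u, v} B) (n : ℤ), P M.toHot → P (M.shift n).toHot
  cone : ∀ {K L : CDGModule.{u, v} B} (f : K ⟶ L), P K.toHot → P L.toHot → P (cone f).toHot

/-- A thick subcategory of the homotopy category: a full triangulated subcategory closed under
direct summands. -/
structure IsThickSubcategory (P : ObjectProperty (Hot.{u, v} B)) : Prop
    extends IsTriangulatedSubcategory P where
  retract : P.IsStableUnderRetracts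

/-- `M` is absolutely acyclic: it belongs to the minimal thick subcategory of the homotopy category
containing the totalizations of all short exact sequences. -/
def IsAbsolutelyAcyclic (M : CDGModule.{u, v} B) : Prop :=
  ∀ P : ObjectProperty (Hot.{u, v} B), IsThickSubcategory P →
    (∀ S : ShortExactSeq.{u, v} B, P S.tot.toHot) → P M.toHot

/-- `M` is coacyclic: it belongs to the minimal triangulated subcategory of the homotopy category
containing the totalizations of all short exact sequences and closed under infinite direct sums. -/
def IsCoacyclic (M : CDGModule.{u, v} B) : Prop :=
  ∀ P : ObjectProperty (Hot.{u, v} B), IsTriangulatedSubcategory P →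
    (∀ S : ShortExactSeq.{u, v} B, P S.tot.toHot) →
    (∀ (J : Type v) (N : J → CDGModule.{u, v} B), (∀ j, P (N j).toHot) → P (directSum N).toHot) →
    P M.toHot

/-- `M` is contraacyclic: it belongs to the minimal triangulated subcategory of the homotopy
category containing the totalizations of all short exact sequences and closed under infinite
products. -/
def IsContraacyclic (M : CDGModule.{u, v} B) : Prop :=
  ∀ P : ObjectProperty (Hot.{u, v} B), IsTriangulatedSubcategory P →
    (∀ S : ShortExactSeq.{u, v} B, P S.tot.toHot) →
    (∀ (J : Type v) (N : J → CDGModule.{u, v} B), (∀ j, P (N j).toHot) → P (product N).toHot) →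
    P M.toHot

end CDGModule

/-- A CDG-submodule of `M`: a graded `B`-submodule closed under the differential. -/
@[ext]
structure CDGSubmodule {B : CDGRing.{u}} (M : CDGModule.{u, v} B) where
  carrier : ∀ i, AddSubgroup (M.X i)
  smul_mem : ∀ {i j k : ℤ} (hk : i + j = k) (b : B.deg i) {x : M.X j}, x ∈ carrier j →
    M.smul hk b x ∈ carrier k
  d_mem : ∀ {i j : ℤ} (hj : i + 1 = j) {x : M.X i}, x ∈ carrier i → M.d hj x ∈ carrier j

namespace CDGSubmodule

variable {B : CDGRing.{u}} {M : CDGModule.{u, v} B}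

/-- Inclusion of CDG-submodules. -/
instance : PartialOrder (CDGSubmodule M) :=
  PartialOrder.lift CDGSubmodule.carrier fun _ _ => CDGSubmodule.ext

/-- The whole module. -/
instance : Top (CDGSubmodule M) := ⟨⟨fun _ => ⊤, by simp, by simp⟩⟩

/-- The zero submodule. -/
instance : Bot (CDGSubmodule M) := ⟨⟨fun _ => ⊥, by simp, by simp⟩⟩

/-- A CDG-submodule as a CDG-module. -/
def toCDGModule (K : CDGSubmodule M) : CDGModule.{u, v} B where
  X i := K.carrier i
  smul hk := AddMonoidHom.mk'
    (fun b => AddMonoidHom.mk' (fun x => ⟨M.smul hk b x.1, K.smul_mem hk b x.2⟩)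
      (by intro x y; ext; simp))
    (by intro a b; ext x; simp)
  one_smul x := Subtype.ext (M.one_smul x.1)
  mul_smul hl hm h₁ h₂ a b x := Subtype.ext (M.mul_smul hl hm h₁ h₂ a b x.1)
  d hj := AddMonoidHom.mk' (fun x => ⟨M.d hj x.1, K.d_mem hj x.2⟩) (by intro x y; ext; simp)
  leibniz hi hj hk h₀ h₁ h₂ b x := Subtype.ext (M.leibniz hi hj hk h₀ h₁ h₂ b x.1)
  d_d hj hk hc x := Subtype.ext (M.d_d hj hk hc x.1)

/-- The quotient CDG-module `M / K`. -/
def quotient (K : CDGSubmodule M) : CDGModule.{u, v} B where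
  X i := M.X i ⧸ K.carrier i
  smul {i j k} hk := AddMonoidHom.mk'
    (fun b => QuotientAddGroup.map (K.carrier j) (K.carrier k) (M.smul hk b)
      fun _ hx => K.smul_mem hk b hx)
    (by
      intro a b
      ext x
      exact congrArg _ (congrArg (fun φ : M.X j →+ M.X k => φ x) (map_add (M.smul hk) a b)))
  one_smul x := by
    induction x using QuotientAddGroup.induction_on with
    | H x => exact congrArg _ (M.one_smul x)
  mul_smul hl hm h₁ h₂ a b x := by
    induction x using QuotientAddGroup.induction_on with
    | H x => exact congrArg _ (M.mul_smul hl hm h₁ h₂ a b x)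
  d {i j} hj := QuotientAddGroup.map (K.carrier i) (K.carrier j) (M.d hj)
    fun _ hx => K.d_mem hj hx
  leibniz hi hj hk h₀ h₁ h₂ b x := by
    induction x using QuotientAddGroup.induction_on with
    | H x => exact congrArg _ (M.leibniz hi hj hk h₀ h₁ h₂ b x)
  d_d hj hk hc x := by
    induction x using QuotientAddGroup.induction_on with
    | H x => exact congrArg _ (M.d_d hj hk hc x)

/-- The intersection `F ∩ G` as a CDG-submodule of `G`; it is `F` itself when `F ≤ G`. -/
def restrict (F G : CDGSubmodule M) : CDGSubmodule G.toCDGModule where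
  carrier i := (F.carrier i).addSubgroupOf (G.carrier i)
  smul_mem hk b _ hx := F.smul_mem hk b hx
  d_mem hj _ hx := F.d_mem hj hx

/-- The subquotient `G / F` of `M`, for CDG-submodules `F ≤ G`. -/
def subquotient (F G : CDGSubmodule M) : CDGModule.{u, v} B := (restrict F G).quotient

/-- A decreasing filtration `F⁰ ≥ F¹ ≥ ⋯` is (separated and) complete: the natural map from `M` to
the limit of the quotients `M / Fⁱ` (of graded modules) is bijective, that is, in each degree `k`
every compatible family of elements of the `(M / Fⁱ)ᵏ` comes from a unique element of `Mᵏ`. -/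
def IsComplete (F : ℕ → CDGSubmodule M) (hF : Antitone F) : Prop :=
  ∀ (k : ℤ) (y : ∀ i : ℕ, M.X k ⧸ (F i).carrier k),
    (∀ i : ℕ, QuotientAddGroup.map ((F (i + 1)).carrier k) ((F i).carrier k) (AddMonoidHom.id _)
      (hF i.le_succ k) (y (i + 1)) = y i) →
    ∃! x : M.X k, ∀ i : ℕ, QuotientAddGroup.mk x = y i

end CDGSubmodule

/-! ### Rotating the triangle of a cone in the homotopy category. -/

namespace CDGModule

variable {B : CDGRing.{u}}

/-! Let `P` be a triangulated subcategory containing all totalizations. Since the totalization of `0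
→ K → L → M → 0` is the cone of `cone f ⟶ M`, membership in `P` has the two-out-of-three property on
every short exact sequence. The definition gives only closure under shifts and cones, so the
triangle must first be rotated: `coneConeInlIso` identifies the cone of `L ⟶ cone f` with `K[1]` up
to homotopy, whence `of_cone_of_target`, `of_cone_of_source` and the lemmas `of_shortExact_*`.

Part (a) is then induction along `0 → F_i → F_{i+1} → F_{i+1}/F_i → 0`. For (b) the same induction
puts every `F_i` in `P`, hence also `⨁ F_n`, and the telescope sequence `0 → ⨁ F_n → ⨁ F_n → N → 0`
(`telescopeShortExact`) gives `N`. For (c), induction along `0 → F^i/F^{i+1} → Q/F^{i+1} → Q/F^i →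
0` handles the quotients, and `cotelescopeShortExact` gives `0 → Q → ∏ Q/F^n → ∏ Q/F^n → 0`:
completeness yields exactness at the first two terms, surjectivity of the transition maps (vanishing
of the first derived limit) yields it at the last. -/

/-- The identification of the components `Mⁱ` and `Mʲ` for `i = j`. -/
def castHom (M : CDGModule.{u, v} B) {i j : ℤ} (h : i = j) : M.X i →+ M.X j :=
  Hom.fEq (𝟙 M) h

@[simp] lemma castHom_castHom (M : CDGModule.{u, v} B) {i j k : ℤ} (h : i = j) (h' : j = k)
    (x : M.X i) : M.castHom h' (M.castHom h x) = M.castHom (h.trans h') x := by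
  subst h h'; rfl

lemma castHom_smul (M : CDGModule.{u, v} B) {i j k j' k' : ℤ} (hk : i + j = k) (hj : j = j')
    (hkk : k = k') (b : B.deg i) (x : M.X j) :
    M.castHom hkk (M.smul hk b x) = M.smul (by omega) b (M.castHom hj x) := by
  subst hj hkk; rfl

lemma castHom_d (M : CDGModule.{u, v} B) {i j i' j' : ℤ} (h : i + 1 = j) (hi : i = i')
    (hj : j = j') (x : M.X i) :
    M.castHom hj (M.d h x) = M.d (by omega) (M.castHom hi x) := by
  subst hi hj; rfl

/-- A bijective closed morphism is an isomorphism. -/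
noncomputable def isoOfBijective {M N : CDGModule.{u, v} B} (f : M ⟶ N)
    (hf : ∀ i, Function.Bijective (f.f i)) : M ≅ N where
  hom := f
  inv :=
    { f := fun i => (AddEquiv.ofBijective (f.f i) (hf i)).symm.toAddMonoidHom
      map_smul := by
        intro i j k hk b x
        apply (hf k).1
        obtain ⟨y, rfl⟩ := (hf j).2 x
        have e : ∀ i (y : M.X i), (AddEquiv.ofBijective (f.f i) (hf i)).symm (f.f i y) = y :=
          fun i y => (AddEquiv.ofBijective (f.f i) (hf i)).symm_apply_apply y
        have e' : ∀ i (y : N.X i), f.f i ((AddEquiv.ofBijective (f.f i) (hf i)).symm y) = y :=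
          fun i y => (AddEquiv.ofBijective (f.f i) (hf i)).apply_symm_apply y
        simp [e, e', f.map_smul]
      map_d := by
        intro i j hj x
        apply (hf j).1
        obtain ⟨y, rfl⟩ := (hf i).2 x
        have e : ∀ i (y : M.X i), (AddEquiv.ofBijective (f.f i) (hf i)).symm (f.f i y) = y :=
          fun i y => (AddEquiv.ofBijective (f.f i) (hf i)).symm_apply_apply y
        have e' : ∀ i (y : N.X i), f.f i ((AddEquiv.ofBijective (f.f i) (hf i)).symm y) = y :=
          fun i y => (AddEquiv.ofBijective (f.f i) (hf i)).apply_symm_apply y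
        simp [e, e', f.map_d] }
  hom_inv_id := by
    refine Hom.ext (funext fun i => AddMonoidHom.ext fun x => ?_)
    exact (AddEquiv.ofBijective (f.f i) (hf i)).symm_apply_apply x
  inv_hom_id := by
    refine Hom.ext (funext fun i => AddMonoidHom.ext fun x => ?_)
    exact (AddEquiv.ofBijective (f.f i) (hf i)).apply_symm_apply x

/-- The isomorphism `M[1][-1] ≅ M`. -/
noncomputable def shiftShiftIso (M : CDGModule.{u, v} B) : (M.shift 1).shift (-1) ≅ M :=
  isoOfBijective
    { f := fun i => M.castHom (show i + -1 + 1 = i by omega)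
      map_smul := by
        intro i j k hk b x
        change M.castHom _ ((-1 * i).negOnePow • (1 * i).negOnePow • M.smul _ b x) = _
        -- The signs of the two shifts cancel, on the action here and on the differential below, so
        -- only a change of index remains.
        rw [smul_smul, ← Int.negOnePow_add, show -1 * i + 1 * i = 0 by ring, Int.negOnePow_zero,
          _root_.one_smul]
        exact M.castHom_smul _ _ _ b x
      map_d := by
        intro i j hj x
        change M.castHom _ ((-1 : ℤ).negOnePow • (1 : ℤ).negOnePow • M.d _ x) = _
        rw [smul_smul, ← Int.negOnePow_add, show (-1 : ℤ) + 1 = 0 by ring, Int.negOnePow_zero,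
          _root_.one_smul]
        exact M.castHom_d _ _ _ x }
    fun i => Function.bijective_iff_has_inverse.2
      ⟨M.castHom (by omega), fun x => M.castHom_castHom _ _ x, fun x => M.castHom_castHom _ _ x⟩

/-- The canonical morphism from the target of a morphism to its cone. -/
def coneInl {K L : CDGModule.{u, v} B} (f : K ⟶ L) : L ⟶ cone f where
  f i := AddMonoidHom.inl _ _
  map_smul {i j k} hk b x := by
    refine Prod.ext rfl ?_
    change 0 = i.negOnePow • K.smul _ b 0
    simp
  map_d {i j} hj x := by
    subst hj
    refine Prod.ext ?_ ?_
    · change L.d rfl x = L.d rfl x + f.f _ 0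
      simp
    · change 0 = -K.d _ 0
      simp

/-- The projection of the cone of `L ⟶ cone f` onto `K[1]`. -/
def coneConeInlDesc {K L : CDGModule.{u, v} B} (f : K ⟶ L) : cone (coneInl f) ⟶ K.shift 1 where
  f i := (AddMonoidHom.snd _ _).comp (AddMonoidHom.fst _ _)
  map_smul {i j k} hk b x := by
    change i.negOnePow • K.smul _ b x.1.2 = (1 * i).negOnePow • K.smul _ b x.1.2
    rw [one_mul]
  map_d {i j} hj x := by
    subst hj
    change -K.d _ x.1.2 + 0 = (1 : ℤ).negOnePow • K.d _ x.1.2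
    simp

/-- The homotopy inverse of `coneConeInlDesc`. -/
def coneConeInlLift {K L : CDGModule.{u, v} B} (f : K ⟶ L) : K.shift 1 ⟶ cone (coneInl f) where
  -- The entry `-f k` is forced by closedness: the first coordinate of the differential of `((0, k),
  -- l')` is `f k + l'`.
  f i := ((AddMonoidHom.inr (L.X i) (K.X (i + 1)))).prod (-f.f (i + 1))
  map_smul {i j k} hk b x := by
    refine Prod.ext (Prod.ext ?_ ?_) ?_
    · change 0 = L.smul hk b 0
      simp
    · change (1 * i).negOnePow • K.smul _ b x = i.negOnePow • K.smul _ b x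
      rw [one_mul]
    · change -f.f (k + 1) ((1 * i).negOnePow • K.smul _ b x) =
        i.negOnePow • L.smul _ b (-f.f (j + 1) x)
      simp only [Units.smul_def, map_zsmul, map_neg, smul_neg, one_mul]
      exact congrArg (fun y => -((i.negOnePow : ℤ) • y))
        (f.map_smul (show i + (j + 1) = k + 1 by omega) b x)
  map_d {i j} hj x := by
    subst hj
    refine Prod.ext (Prod.ext ?_ ?_) ?_
    · change 0 = L.d rfl 0 + f.f _ x + -f.f _ x
      simp
    · change (1 : ℤ).negOnePow • K.d _ x = -K.d _ x + 0
      simp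
    · change -f.f _ ((1 : ℤ).negOnePow • K.d _ x) = -L.d _ (-f.f _ x)
      simp only [Int.negOnePow_one, Units.neg_smul, _root_.one_smul, map_neg, neg_neg]
      exact f.map_d rfl x

/-- This composite is the identity strictly; only the other one needs a homotopy. -/
lemma coneConeInlLift_desc {K L : CDGModule.{u, v} B} (f : K ⟶ L) :
    coneConeInlLift f ≫ coneConeInlDesc f = 𝟙 _ := rfl

/-- The homotopy between the composite of `coneConeInlDesc` and `coneConeInlLift` and the
identity. -/
def coneConeInlHomotopy {K L : CDGModule.{u, v} B} (f : K ⟶ L) :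
    Homotopy (coneConeInlDesc f ≫ coneConeInlLift f) (𝟙 (cone (coneInl f))) where
  -- The homotopy `((l, k), l') ↦ ((0, 0), -l)` contracts the two copies of `L`, which the
  -- differential joins by the identity.
  s {i j} h := (AddMonoidHom.inr ((cone f).X j) (L.X (j + 1))).comp
    ((-L.castHom h.symm).comp ((AddMonoidHom.fst _ _).comp (AddMonoidHom.fst _ _)))
  map_smul {i j k j₁ k₁} hk hj₁ hk₁ h₁ b x := by
    subst hj₁ hk₁
    refine Prod.ext (Prod.ext ?_ ?_) ?_
    · change 0 = i.negOnePow • L.smul _ b 0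
      simp
    · change 0 = i.negOnePow • i.negOnePow • K.smul _ b 0
      simp
    · change -L.smul hk b x.1.1 = i.negOnePow • i.negOnePow • L.smul _ b (-x.1.1)
      simp [smul_smul]
  eq {i j k} hi hj x := by
    subst hi hj
    refine Prod.ext (Prod.ext ?_ ?_) ?_
    · change 0 - x.1.1 = L.d rfl 0 + f.f _ 0 + -x.1.1 + 0
      simp
    · change x.1.2 - x.1.2 = -K.d _ 0 + 0 + 0
      simp
    · change -f.f _ x.1.2 - x.2 = -L.d _ (-x.1.1) + -(L.d _ x.1.1 + f.f _ x.1.2 + x.2)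
      simp
      abel

/-- The homotopy equivalence between the cone of `L ⟶ cone f` and `K[1]`. -/
noncomputable def coneConeInlIso {K L : CDGModule.{u, v} B} (f : K ⟶ L) :
    (cone (coneInl f)).toHot ≅ (K.shift 1).toHot where
  hom := (Quotient.functor _).map (coneConeInlDesc f)
  inv := (Quotient.functor _).map (coneConeInlLift f)
  hom_inv_id := by
    rw [← Functor.map_comp]
    exact (CategoryTheory.Quotient.sound _ ⟨coneConeInlHomotopy f⟩).trans
      (CategoryTheory.Functor.map_id _ _)
  inv_hom_id := by
    rw [← Functor.map_comp, coneConeInlLift_desc]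
    exact CategoryTheory.Functor.map_id _ _

/-! ### Two out of three for cones and for short exact sequences. -/

namespace IsTriangulatedSubcategory

variable {P : ObjectProperty (Hot.{u, v} B)}

lemma of_iso (hP : IsTriangulatedSubcategory P) {M N : CDGModule.{u, v} B} (e : M ≅ N)
    (h : P M.toHot) : P N.toHot :=
  have := hP.iso
  P.prop_of_iso ((Quotient.functor _).mapIso e) h

/-- The cone of `L ⟶ cone f` lies in `P` and is homotopy equivalent to `K[1]`; shifting back gives
`K`. -/
lemma of_cone_of_target (hP : IsTriangulatedSubcategory P) {K L : CDGModule.{u, v} B} (f : K ⟶ L)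
    (hL : P L.toHot) (hf : P (CDGModule.cone f).toHot) : P K.toHot := by
  have := hP.iso
  exact hP.of_iso K.shiftShiftIso
    (hP.shift _ _ (P.prop_of_iso (coneConeInlIso f) (hP.cone (coneInl f) hL hf)))

/-- This is `of_cone_of_target` for the rotated morphism `L ⟶ cone f`, whose cone is `K[1]`. -/
lemma of_cone_of_source (hP : IsTriangulatedSubcategory P) {K L : CDGModule.{u, v} B} (f : K ⟶ L)
    (hK : P K.toHot) (hf : P (CDGModule.cone f).toHot) : P L.toHot := by
  have := hP.iso
  exact hP.of_cone_of_target (coneInl f) hf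
    (P.prop_of_iso (coneConeInlIso f).symm (hP.shift K 1 hK))

/-- The start of all inductions on filtrations: a zero module is isomorphic to the totalization of
the exact sequence with three zero terms. -/
lemma of_subsingleton (hP : IsTriangulatedSubcategory P)
    (hS : ∀ S : ShortExactSeq.{u, v} B, P S.tot.toHot) (Z : CDGModule.{u, v} B)
    (hZ : ∀ i, Subsingleton (Z.X i)) : P Z.toHot := by
  let S : ShortExactSeq.{u, v} B :=
    { K := Z, L := Z, M := Z, f := 𝟙 Z, g := 𝟙 Z
      injective := fun i => Function.injective_id
      exact := fun i x => ⟨fun _ => ⟨x, rfl⟩, fun _ => Subsingleton.elim _ _⟩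
      surjective := fun i => Function.surjective_id }
  have hT : ∀ i, Subsingleton (S.tot.X i) := fun i =>
    inferInstanceAs (Subsingleton (Z.X i × (Z.X (i + 1) × Z.X (i + 1 + 1))))
  refine hP.of_iso (isoOfBijective (M := S.tot)
    { f := fun i => 0
      map_smul := fun _ _ _ => Subsingleton.elim _ _
      map_d := fun _ _ => Subsingleton.elim _ _ } fun i => ?_) (hS S)
  exact ⟨fun _ _ _ => Subsingleton.elim _ _, fun x => ⟨0, Subsingleton.elim _ _⟩⟩

/-- The cone of `f` is the intermediate object: `M` and the totalization determine it, then `K` and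
`cone f` give `L`. The next two lemmas run through the same two triangles in other orders. -/
lemma of_shortExact_middle (hP : IsTriangulatedSubcategory P) (S : ShortExactSeq.{u, v} B)
    (hS : P S.tot.toHot) (hK : P S.K.toHot) (hM : P S.M.toHot) : P S.L.toHot :=
  hP.of_cone_of_source S.f hK (hP.of_cone_of_target _ hM hS)

lemma of_shortExact_right (hP : IsTriangulatedSubcategory P) (S : ShortExactSeq.{u, v} B)
    (hS : P S.tot.toHot) (hK : P S.K.toHot) (hL : P S.L.toHot) : P S.M.toHot :=
  hP.of_cone_of_source _ (hP.cone S.f hK hL) hS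

lemma of_shortExact_left (hP : IsTriangulatedSubcategory P) (S : ShortExactSeq.{u, v} B)
    (hS : P S.tot.toHot) (hL : P S.L.toHot) (hM : P S.M.toHot) : P S.K.toHot :=
  hP.of_cone_of_target S.f hL (hP.of_cone_of_target _ hM hS)

end IsTriangulatedSubcategory

end CDGModule

/-! ### Short exact sequences attached to submodules and filtrations. -/

namespace CDGSubmodule

open CDGModule

variable {B : CDGRing.{u}} {M : CDGModule.{u, v} B}

/-- The inclusion morphism of a CDG-submodule. -/
def subtype (F : CDGSubmodule M) : F.toCDGModule ⟶ M where
  f i := (F.carrier i).subtype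
  map_smul _ _ _ := rfl
  map_d _ _ := rfl

/-- The inclusion morphism between CDG-submodules. -/
def inclusion {F G : CDGSubmodule M} (h : F ≤ G) : F.toCDGModule ⟶ G.toCDGModule where
  f i := AddSubgroup.inclusion (h i)
  map_smul _ _ _ := rfl
  map_d _ _ := rfl

/-- The projection onto a quotient CDG-module. -/
def mkQ (F : CDGSubmodule M) : M ⟶ F.quotient where
  f i := QuotientAddGroup.mk' (F.carrier i)
  map_smul _ _ _ := rfl
  map_d _ _ := rfl

/-- The projection `M / F ⟶ M / G` for `F ≤ G`. -/
def quotientMap {F G : CDGSubmodule M} (h : F ≤ G) : F.quotient ⟶ G.quotient where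
  f i := QuotientAddGroup.map (F.carrier i) (G.carrier i) (AddMonoidHom.id _) (h i)
  map_smul _ _ x := by
    induction x using QuotientAddGroup.induction_on with
    | H x => rfl
  map_d _ x := by
    induction x using QuotientAddGroup.induction_on with
    | H x => rfl

/-- The morphism `G / F ⟶ M / F` for `F ≤ G`. -/
def subquotientMap (F G : CDGSubmodule M) : subquotient F G ⟶ F.quotient where
  f i := QuotientAddGroup.map ((restrict F G).carrier i) (F.carrier i) (G.carrier i).subtype
    fun _ hx => hx
  map_smul _ _ x := by
    induction x using QuotientAddGroup.induction_on with
    | H x => rfl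
  map_d _ x := by
    induction x using QuotientAddGroup.induction_on with
    | H x => rfl

/-- The short exact sequence `0 ⟶ F ⟶ G ⟶ G / F ⟶ 0`. -/
def subquotientShortExact {F G : CDGSubmodule M} (h : F ≤ G) : ShortExactSeq.{u, v} B where
  K := F.toCDGModule
  L := G.toCDGModule
  M := subquotient F G
  f := inclusion h
  g := (restrict F G).mkQ
  injective i := AddSubgroup.inclusion_injective (h i)
  exact i x := by
    refine (QuotientAddGroup.eq_zero_iff x).trans ⟨fun hx => ⟨⟨x.1, hx⟩, rfl⟩, ?_⟩
    rintro ⟨y, rfl⟩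
    exact y.2
  surjective i := QuotientAddGroup.mk'_surjective _

/-- The short exact sequence `0 ⟶ G / F ⟶ M / F ⟶ M / G ⟶ 0`. -/
def quotientShortExact {F G : CDGSubmodule M} (h : F ≤ G) : ShortExactSeq.{u, v} B where
  K := subquotient F G
  L := F.quotient
  M := G.quotient
  f := subquotientMap F G
  g := quotientMap h
  injective i := by
    refine (injective_iff_map_eq_zero _).2 fun x => ?_
    induction x using QuotientAddGroup.induction_on with
    | H x =>
      intro hx
      exact (QuotientAddGroup.eq_zero_iff x).2 ((QuotientAddGroup.eq_zero_iff x.1).1 hx)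
  exact i x := by
    induction x using QuotientAddGroup.induction_on with
    | H x =>
      refine (QuotientAddGroup.eq_zero_iff x).trans
        ⟨fun hx => ⟨QuotientAddGroup.mk ⟨x, hx⟩, rfl⟩, ?_⟩
      rintro ⟨y, hy⟩
      induction y using QuotientAddGroup.induction_on with
      | H y =>
        have : -y.1 + x ∈ F.carrier i := QuotientAddGroup.eq.1 hy
        simpa using (G.carrier i).add_mem y.2 (h i this)
  surjective i x := by
    induction x using QuotientAddGroup.induction_on with
    | H x => exact ⟨QuotientAddGroup.mk x, rfl⟩

/-- The top submodule is isomorphic to the whole module. -/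
noncomputable def topIso (M : CDGModule.{u, v} B) : (⊤ : CDGSubmodule M).toCDGModule ≅ M :=
  isoOfBijective (subtype ⊤) fun _ =>
    ⟨Subtype.val_injective, fun x => ⟨⟨x, AddSubgroup.mem_top x⟩, rfl⟩⟩

/-! ### The telescope of an exhaustive filtration. -/

section Telescope

variable (F : ℕ → CDGSubmodule M)

/-- The direct sum of the terms of a filtration. -/
abbrev filtrationSum : CDGModule.{u, v} B :=
  -- The lift is there because `directSum` takes index types in `Type v`.
  directSum fun j : ULift.{v} ℕ => (F j.down).toCDGModule

/-- The component of an element of the direct sum, as an element of `M`. -/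
def sumCoord {k : ℤ} (x : (filtrationSum F).X k) (n : ℕ) : M.X k :=
  (DFinsupp.toFun x ⟨n⟩ : (F n).carrier k).1

/-- Reading all components in `M` lets neighbouring ones be subtracted without inclusion maps. With
`exists_sumCoord_eq`, the direct sum becomes the finitely supported sequences in `M` whose `n`-th
term lies in `F n`. -/
lemma sumCoord_ext {k : ℤ} {x y : (filtrationSum F).X k}
    (h : ∀ n, sumCoord F x n = sumCoord F y n) : x = y :=
  DFinsupp.ext fun ⟨n⟩ => Subtype.ext (h n)

lemma sumCoord_add {k : ℤ} (x y : (filtrationSum F).X k) (n : ℕ) :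
    sumCoord F (x + y) n = sumCoord F x n + sumCoord F y n := rfl

lemma sumCoord_smul {i j k : ℤ} (hk : i + j = k) (b : B.deg i) (x : (filtrationSum F).X j)
    (n : ℕ) : sumCoord F ((filtrationSum F).smul hk b x) n = M.smul hk b (sumCoord F x n) := rfl

lemma sumCoord_d {i j : ℤ} (hj : i + 1 = j) (x : (filtrationSum F).X i) (n : ℕ) :
    sumCoord F ((filtrationSum F).d hj x) n = M.d hj (sumCoord F x n) := rfl

lemma sumCoord_mem {k : ℤ} (x : (filtrationSum F).X k) (n : ℕ) :
    sumCoord F x n ∈ (F n).carrier k := (DFinsupp.toFun x ⟨n⟩ : (F n).carrier k).2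

lemma sumCoord_eventually {k : ℤ} (x : (filtrationSum F).X k) :
    ∃ N, ∀ n, N ≤ n → sumCoord F x n = 0 := by
  classical
  let x' : Π₀ j : ULift.{v} ℕ, (F j.down).carrier k := x
  obtain ⟨N, hN⟩ := (x'.support.image ULift.down).bddAbove
  refine ⟨N + 1, fun n hn => by_contra fun h => ?_⟩
  have : n ≤ N := hN (Finset.mem_coe.2 (Finset.mem_image.2
    ⟨⟨n⟩, DFinsupp.mem_support_iff.2 fun h' => h (congrArg Subtype.val h'), rfl⟩))
  omega

lemma exists_sumCoord_eq {k : ℤ} (y : ℕ → M.X k) (hy : ∀ n, y n ∈ (F n).carrier k) (N : ℕ)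
    (hN : ∀ n, N ≤ n → y n = 0) : ∃ x : (filtrationSum F).X k, ∀ n, sumCoord F x n = y n := by
  classical
  let s : Finset (ULift.{v} ℕ) := (Finset.range N).map ⟨ULift.up, ULift.up_injective⟩
  have hs : ∀ n, ULift.up n ∈ s ↔ n < N := fun n => by simp [s]
  let x : Π₀ j : ULift.{v} ℕ, (F j.down).carrier k := DFinsupp.mk s fun n => ⟨y n.1.down, hy _⟩
  refine ⟨x, fun n => ?_⟩
  change (x ⟨n⟩ : M.X k) = y n
  by_cases h : n < N
  · rw [DFinsupp.mk_of_mem ((hs n).2 h)]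
  · rw [DFinsupp.mk_of_notMem (mt (hs n).1 h), hN n (by omega), ZeroMemClass.coe_zero]

/-- The sequence `xₙ - xₙ₋₁` of differences of the components of `x`. -/
def sumCoordDiff {k : ℤ} (x : (filtrationSum F).X k) : ℕ → M.X k
  | 0 => sumCoord F x 0
  | n + 1 => sumCoord F x (n + 1) - sumCoord F x n

/-- Partial sums invert differences. This gives both injectivity of the telescope map and the
vanishing of its composite with summation. -/
lemma sum_sumCoordDiff {k : ℤ} (x : (filtrationSum F).X k) (n : ℕ) :
    ∑ i ∈ Finset.range (n + 1), sumCoordDiff F x i = sumCoord F x n := by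
  induction n with
  | zero => simp [sumCoordDiff]
  | succ n ih => rw [Finset.sum_range_succ, ih]; simp [sumCoordDiff]

lemma exists_sumCoord_eq_diff {F : ℕ → CDGSubmodule M} (hF : Monotone F) {k : ℤ}
    (x : (filtrationSum F).X k) :
    ∃ y : (filtrationSum F).X k, ∀ n, sumCoord F y n = sumCoordDiff F x n := by
  obtain ⟨N, hN⟩ := sumCoord_eventually F x
  -- The bound grows by one because the `n`-th difference involves the component `n - 1`.
  refine exists_sumCoord_eq F _ (fun n => ?_) (N + 1) fun n hn => ?_
  · cases n with
    | zero => exact sumCoord_mem F x 0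
    | succ n => exact sub_mem (sumCoord_mem F x _) (hF n.le_succ k (sumCoord_mem F x n))
  · obtain ⟨n, rfl⟩ := Nat.exists_eq_succ_of_ne_zero (show n ≠ 0 by omega)
    simp [sumCoordDiff, hN n (by omega), hN (n + 1) (by omega)]

/-- The morphism "identity minus shift" on the direct sum of the terms of a filtration. -/
noncomputable def telescope {F : ℕ → CDGSubmodule M} (hF : Monotone F) :
    filtrationSum F ⟶ filtrationSum F where
  -- The chosen element is determined by its coordinates, so additivity and compatibility can be
  -- checked on them.
  f k := AddMonoidHom.mk' (fun x => (exists_sumCoord_eq_diff hF x).choose) fun x y => by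
    refine sumCoord_ext F fun n => ?_
    rw [sumCoord_add, (exists_sumCoord_eq_diff hF _).choose_spec,
      (exists_sumCoord_eq_diff hF _).choose_spec, (exists_sumCoord_eq_diff hF _).choose_spec]
    cases n <;> simp only [sumCoordDiff, sumCoord_add]
    abel
  map_smul {i j k} hk b x := by
    refine sumCoord_ext F fun n => ?_
    rw [sumCoord_smul]
    refine ((exists_sumCoord_eq_diff hF _).choose_spec n).trans
      (Eq.trans ?_ (congrArg _ ((exists_sumCoord_eq_diff hF x).choose_spec n).symm))
    cases n <;> simp only [sumCoordDiff, sumCoord_smul, map_sub]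
  map_d {i j} hj x := by
    refine sumCoord_ext F fun n => ?_
    rw [sumCoord_d]
    refine ((exists_sumCoord_eq_diff hF _).choose_spec n).trans
      (Eq.trans ?_ (congrArg _ ((exists_sumCoord_eq_diff hF x).choose_spec n).symm))
    cases n <;> simp only [sumCoordDiff, sumCoord_d, map_sub]

lemma sumCoord_telescope {F : ℕ → CDGSubmodule M} (hF : Monotone F) {k : ℤ}
    (x : (filtrationSum F).X k) (n : ℕ) :
    sumCoord F ((telescope hF).f k x) n = sumCoordDiff F x n :=
  (exists_sumCoord_eq_diff hF x).choose_spec n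

lemma finite_support_sumCoord {k : ℤ} (x : (filtrationSum F).X k) :
    (Function.support (sumCoord F x)).Finite := by
  obtain ⟨N, hN⟩ := sumCoord_eventually F x
  exact (Set.finite_lt_nat N).subset fun n hn => not_le.1 fun h => hn (hN n h)

/-- The summation morphism from the direct sum of the terms of a filtration. -/
noncomputable def filtrationSumDesc : filtrationSum F ⟶ M where
  f _ := AddMonoidHom.mk' (fun x => ∑ᶠ n, sumCoord F x n) fun x y =>
    finsum_add_distrib (finite_support_sumCoord F x) (finite_support_sumCoord F y)
  map_smul hk b x := ((M.smul hk b).map_finsum (finite_support_sumCoord F x)).symm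
  map_d hj x := ((M.d hj).map_finsum (finite_support_sumCoord F x)).symm

lemma filtrationSumDesc_eq_sum {k : ℤ} (x : (filtrationSum F).X k) {N : ℕ}
    (hN : ∀ n, N ≤ n → sumCoord F x n = 0) :
    (filtrationSumDesc F).f k x = ∑ n ∈ Finset.range N, sumCoord F x n :=
  finsum_eq_sum_of_support_subset _ fun n hn =>
    Finset.mem_coe.2 (Finset.mem_range.2 (not_le.1 fun h => hn (hN n h)))

/-- The telescope short exact sequence `0 ⟶ ⨁ Fₙ ⟶ ⨁ Fₙ ⟶ M ⟶ 0` of an exhaustive filtration. -/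
noncomputable def telescopeShortExact {F : ℕ → CDGSubmodule M} (hF : Monotone F)
    (h : ∀ (k : ℤ) (x : M.X k), ∃ i : ℕ, x ∈ (F i).carrier k) : ShortExactSeq.{u, v} B where
  K := filtrationSum F
  L := filtrationSum F
  M := M
  f := telescope hF
  g := filtrationSumDesc F
  injective k := by
    refine (injective_iff_map_eq_zero _).2 fun x hx => sumCoord_ext F fun n => ?_
    rw [← sum_sumCoordDiff]
    refine Finset.sum_eq_zero fun i _ => ?_
    rw [← sumCoord_telescope hF, hx]
    rfl
  exact k x := by
    constructor
    · intro hx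
      obtain ⟨N, hN⟩ := sumCoord_eventually F x
      -- The preimage is the sequence of partial sums: the `n`-th lies in `F n` by monotonicity, and
      -- from `N` on it equals the total sum, which is zero.
      obtain ⟨z, hz⟩ := exists_sumCoord_eq F
        (fun n => ∑ i ∈ Finset.range (n + 1), sumCoord F x i)
        (fun n => sum_mem fun i hi =>
          hF (Nat.lt_succ_iff.1 (Finset.mem_range.1 hi)) k (sumCoord_mem F x i)) N
        fun n hn => (filtrationSumDesc_eq_sum F x fun m hm => hN m (by omega)).symm.trans hx
      refine ⟨z, sumCoord_ext F fun n => ?_⟩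
      rw [sumCoord_telescope]
      cases n with
      | zero => simp [sumCoordDiff, hz]
      | succ n =>
        rw [sumCoordDiff, hz, hz, Finset.sum_range_succ _ (n + 1), add_sub_cancel_left]
    · rintro ⟨z, rfl⟩
      obtain ⟨N, hN⟩ := sumCoord_eventually F z
      obtain ⟨N', hN'⟩ := sumCoord_eventually F ((telescope hF).f k z)
      -- The bound covers both supports; the summand `1` makes the sum of differences collapse to
      -- component `N + N'` of `z`, which vanishes.
      rw [filtrationSumDesc_eq_sum F _ (N := N + N' + 1) fun n hn => hN' n (by omega)]
      simp only [sumCoord_telescope]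
      rw [sum_sumCoordDiff, hN _ (by omega)]
  surjective k x := by
    obtain ⟨i, hi⟩ := h k x
    obtain ⟨y, hy⟩ := exists_sumCoord_eq F (Pi.single i x)
      (fun n => by
        rcases eq_or_ne n i with rfl | hn
        · simpa using hi
        · simp [hn])
      (i + 1) fun n hn => Pi.single_eq_of_ne (by omega) _
    refine ⟨y, (finsum_eq_single _ i fun n hn => ?_).trans ?_⟩
    · rw [hy, Pi.single_eq_of_ne hn]
    · rw [hy, Pi.single_eq_same]

end Telescope

/-! ### The dual telescope of a complete filtration. -/

section Cotelescope

variable {F : ℕ → CDGSubmodule M} (hF : Antitone F)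

/-- The product of the quotients by the terms of a decreasing filtration. -/
abbrev quotientProduct (F : ℕ → CDGSubmodule M) : CDGModule.{u, v} B :=
  product fun j : ULift.{v} ℕ => (F j.down).quotient

/-- The morphism "identity minus shift" on the product of the quotients `M / Fⁿ`. -/
def cotelescope : quotientProduct F ⟶ quotientProduct F where
  f k := AddMonoidHom.mk' (fun x n => x n - (quotientMap (hF n.down.le_succ)).f k (x ⟨n.down + 1⟩))
    fun x y => by
      funext n
      change x n + y n - (quotientMap _).f k (x ⟨n.down + 1⟩ + y ⟨n.down + 1⟩) =
        x n - (quotientMap _).f k (x ⟨n.down + 1⟩) + (y n - (quotientMap _).f k (y ⟨n.down + 1⟩))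
      rw [map_add]
      abel
  map_smul hk b x := by
    funext n
    refine Eq.trans ?_ (map_sub ((F n.down).quotient.smul hk b) _ _).symm
    exact congrArg (fun z => (F n.down).quotient.smul hk b (x n) - z)
      ((quotientMap (hF n.down.le_succ)).map_smul hk b (x ⟨n.down + 1⟩))
  map_d hj x := by
    funext n
    refine Eq.trans ?_ (map_sub ((F n.down).quotient.d hj) _ _).symm
    exact congrArg (fun z => (F n.down).quotient.d hj (x n) - z)
      ((quotientMap (hF n.down.le_succ)).map_d hj (x ⟨n.down + 1⟩))

/-- The morphism from `M` to the product of the quotients `M / Fⁿ`. -/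
def quotientProductLift (F : ℕ → CDGSubmodule M) : M ⟶ quotientProduct F where
  f _ := AddMonoidHom.mk' (fun x _ => QuotientAddGroup.mk x) fun _ _ => rfl
  map_smul _ _ _ := rfl
  map_d _ _ := rfl

/-- The short exact sequence `0 ⟶ M ⟶ ∏ M / Fⁿ ⟶ ∏ M / Fⁿ ⟶ 0` of a complete filtration. -/
def cotelescopeShortExact (h : IsComplete F hF) : ShortExactSeq.{u, v} B where
  K := M
  L := quotientProduct F
  M := quotientProduct F
  f := quotientProductLift F
  g := cotelescope hF
  -- Uniqueness in the definition of completeness.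
  injective k x y hxy :=
    (h k (fun i => QuotientAddGroup.mk x) fun _ => rfl).unique (fun _ => rfl)
      fun i => (congrFun hxy ⟨i⟩).symm
  exact k x := by
    constructor
    · intro hx
      -- The kernel of `cotelescope` consists of the compatible families, and completeness supplies
      -- an element inducing each of them.
      obtain ⟨y, hy, -⟩ := h k (fun i => x ⟨i⟩) fun i => (sub_eq_zero.1 (congrFun hx ⟨i⟩)).symm
      exact ⟨y, funext fun n => hy n.down⟩
    · rintro ⟨y, rfl⟩
      exact funext fun n => sub_self _
  surjective k y := by
    have hs : ∀ n, Function.Surjective ((quotientMap (hF (Nat.le_succ n))).f k) := fun n =>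
      (quotientShortExact (hF (Nat.le_succ n))).surjective k
    -- Solve `x_n - π(x_{n+1}) = y_n` recursively, where `π` is the transition map: begin with `0`
    -- and take `x_{n+1}` to be any lift of `x_n - y_n`.
    let x : ∀ n, (F n).quotient.X k := fun n =>
      Nat.rec 0 (fun n a => (hs n (a - y ⟨n⟩)).choose) n
    refine ⟨fun n => x n.down, funext fun n => ?_⟩
    have hx : (quotientMap (hF n.down.le_succ)).f k (x (n.down + 1)) = x n.down - y n :=
      (hs n.down (x n.down - y n)).choose_spec
    change x n.down - (quotientMap _).f k (x (n.down + 1)) = y n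
    rw [hx, sub_sub_cancel]

end Cotelescope

end CDGSubmodule

/-! ### Induction along filtrations and the theorem. -/

namespace CDGModule.IsTriangulatedSubcategory

open CDGSubmodule

variable {B : CDGRing.{u}} {P : ObjectProperty (Hot.{u, v} B)}

lemma of_subquotient (hP : IsTriangulatedSubcategory P)
    (hS : ∀ S : ShortExactSeq.{u, v} B, P S.tot.toHot) {M : CDGModule.{u, v} B}
    {F G : CDGSubmodule M} (h : F ≤ G) (hF : P F.toCDGModule.toHot)
    (hFG : P (subquotient F G).toHot) : P G.toCDGModule.toHot :=
  hP.of_shortExact_middle (subquotientShortExact h) (hS _) hF hFG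

lemma of_bot (hP : IsTriangulatedSubcategory P)
    (hS : ∀ S : ShortExactSeq.{u, v} B, P S.tot.toHot) (M : CDGModule.{u, v} B) :
    P (⊥ : CDGSubmodule M).toCDGModule.toHot :=
  hP.of_subsingleton hS _ fun i =>
    inferInstanceAs (Subsingleton (⊥ : AddSubgroup (M.X i)))

lemma of_quotient_top (hP : IsTriangulatedSubcategory P)
    (hS : ∀ S : ShortExactSeq.{u, v} B, P S.tot.toHot) (M : CDGModule.{u, v} B) :
    P (⊤ : CDGSubmodule M).quotient.toHot :=
  hP.of_subsingleton hS _ fun i =>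
    QuotientAddGroup.subsingleton_quotient_top (G := M.X i)

end CDGModule.IsTriangulatedSubcategory

theorem mainTheorem2 (B : CDGRing.{u}) :
    (∀ (M : CDGModule.{u, v} B) (n : ℕ) (F : Fin (n + 1) → CDGSubmodule M),
      Monotone F → F 0 = ⊥ → F (Fin.last n) = ⊤ →
      (∀ i : Fin n,
        (CDGSubmodule.subquotient (F i.castSucc) (F i.succ)).IsAbsolutelyAcyclic) →
      M.IsAbsolutelyAcyclic) ∧
    (∀ (N : CDGModule.{u, v} B) (F : ℕ → CDGSubmodule N),
      Monotone F → F 0 = ⊥ → (∀ (k : ℤ) (x : N.X k), ∃ i : ℕ, x ∈ (F i).carrier k) →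
      (∀ i : ℕ, (CDGSubmodule.subquotient (F i) (F (i + 1))).IsCoacyclic) →
      N.IsCoacyclic) ∧
    (∀ (Q : CDGModule.{u, v} B) (F : ℕ → CDGSubmodule Q) (hF : Antitone F),
      F 0 = ⊤ → CDGSubmodule.IsComplete F hF →
      (∀ i : ℕ, (CDGSubmodule.subquotient (F (i + 1)) (F i)).IsContraacyclic) →
      Q.IsContraacyclic) := by
  refine ⟨fun M n F hF h0 hlast hgr P hP hS => ?_, fun N F hF h0 hex hgr P hP hS hsum => ?_,
    fun Q F hF h0 hc hgr P hP hS hprod => ?_⟩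
  -- The subcategory `P` is fixed before the induction, so each step only needs the graded piece to
  -- lie in this `P`.
  · have key : ∀ i : Fin (n + 1), P (F i).toCDGModule.toHot := fun i => by
      induction i using Fin.induction with
      | zero => rw [h0]; exact hP.1.of_bot hS M
      | succ i ih => exact hP.1.of_subquotient hS (hF i.castSucc_le_succ) ih (hgr i P hP hS)
    have := key (Fin.last n)
    rw [hlast] at this
    exact hP.1.of_iso (CDGSubmodule.topIso M) this
  · have key : ∀ i : ℕ, P (F i).toCDGModule.toHot := fun i => by
      induction i with
      | zero => rw [h0]; exact hP.of_bot hS N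
      | succ i ih => exact hP.of_subquotient hS (hF i.le_succ) ih (hgr i P hP hS hsum)
    have hL : P (CDGSubmodule.filtrationSum F).toHot := hsum _ _ fun j => key j.down
    exact hP.of_shortExact_right (CDGSubmodule.telescopeShortExact hF hex) (hS _) hL hL
  -- Here the induction climbs through the quotients, starting from `Q / F 0 = 0`; the submodules `F
  -- i` themselves are not finite extensions of graded pieces.
  · have key : ∀ i : ℕ, P (F i).quotient.toHot := fun i => by
      induction i with
      | zero => rw [h0]; exact hP.of_quotient_top hS Q
      | succ i ih =>
        exact hP.of_shortExact_middle (CDGSubmodule.quotientShortExact (hF i.le_succ)) (hS _)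
          (hgr i P hP hS hprod) ih
    have hL : P (CDGSubmodule.quotientProduct F).toHot := hprod _ _ fun j => key j.down
    exact hP.of_shortExact_left (CDGSubmodule.cotelescopeShortExact hF hc) (hS _) hL hL
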